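/- **Model.** Legitimate nodes $\Phi_l$ and eavesdroppers (EDs) $\Phi_e$ form independent Poisson point processes in $\mathbb R^2$ with densities $\lambda_l,\lambda_e\ge 0$. Time is slotted, $k=0,1,2,\dots$; in every slot every legitimate node transmits with probability $p\in[0,1]$ and otherwise receives, independently over nodes and slots and independently of $\Phi_l,\Phi_e$. Fix $\eta,\beta_l,\beta_e>0$. In slot $k$ there is a *link* from $x$ to $y$ if $x$ transmits, $y$ receives, $\|x-y\|<\eta$, and the disk of radius $\beta_l\|x-y\|$ around $y$ contains no transmitting node other than $x$. An ED *decodes* a hop from $x$ to $y$ if it lies in the disk of radius $\beta_e\|x-y\|$ around $x$; a link is *secure* if no ED decodes it. A *causal route* is a finite sequence of hops used in strictly increasing slots (the trivial route from a node to itself is allowed). **Direct-path scheme (nsp).** A packet travels along a causal route all of whose links are secure. **Split-path scheme (sp).** A *split path* from $x$ to $y$ consists of two different non-trivial causal routes from $x$ to $y$ of (not necessarily secure) links, one for each of two sub-packets, such that no ED decodes both sub-packets (an ED decodes a sub-packet if it decodes some hop of its route). A packet travels along a *two-secure path*: a finite chain of stages, each of which is a secure link or a split path, each stage beginning only after the preceding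 ones are complete. For each scheme, a *giant component* is an infinite set $C\subseteq\Phi_l$ such that for all $x,y\in C$ a packet can travel from $x$ to $y$ within finitely many slots; let $\mathcal S_{\rm nsp}$, $\mathcal S_{\rm sp}$ be the events that a giant component exists under the direct-path scheme and under the split-path scheme. For nodes $x,y$ the minimum delay under a scheme is the least $k\ge 0$ such that a packet can travel from $x$ to $y$ using only the slots $0,\dots,k$ ($\infty$ if there is none). **Lemma.** (i) $\Pr\{\mathcal S_{\rm nsp}\}\le \Pr\{\mathcal S_{\rm sp}\}$. (ii) Let $\mathcal G$ denote the giant component of either one of the two schemes (the set of all nodes that belong to a giant component of that scheme), and suppose that it exists with positive probability. For $n\in\mathbb N$ let $x_0^*$ and $x_n^*$ be the nodes of $\mathcal G$ closest to $(0,0)$ and to $(n,0)$, and let $T_{\rm nsp}(0,n)$, $T_{\rm sp}(0,n)\in[0,\infty]$ be the minimum delays from $x_0^*$ to $x_n^*$ under the two schemes. Then, with $\mathbb E_{|\mathcal G}$ the expectation conditioned on the existence of $\mathcal G$, $$\mathbb E_{|\mathcal G}\,T_{\rm sp}(0,n)\ \le\ \mathbb E_{|\mathcal G}\,T_{\rm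 nsp}(0,n).$$ -/

import Mathlib

open MeasureTheory ProbabilityTheory Set
open scoped ENNReal NNReal

namespace SecureNet

noncomputable section

/-- The Euclidean plane. -/
abbrev Plane : Type := EuclideanSpace ℝ (Fin 2)

/-- The parameters of the model: densities `lamL`, `lamE` of the legitimate nodes and of the
eavesdroppers, slotted-ALOHA transmission probability `p`, communication radius `eta`, interference
parameter `betaL` and eavesdropping parameter `betaE`. -/
structure Params where
  lamL : ℝ≥0
  lamE : ℝ≥0
  p : ℝ
  eta : ℝ
  betaL : ℝ
  betaE : ℝ
  p_mem : p ∈ Icc (0 : ℝ) 1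
  eta_pos : 0 < eta
  betaL_pos : 0 < betaL
  betaE_pos : 0 < betaE

/-! ### One realization of the network -/

/-- One realization of the network. The legitimate nodes are the points `pos i`, `i ∈ nodes`; the
eavesdroppers form the set `eve`; `tx k i` says that the ALOHA protocol lets node `i` transmit in
slot `k`. -/
structure Realization where
  nodes : Set ℕ
  pos : ℕ → Plane
  eve : Set Plane
  tx : ℕ → ℕ → Prop

namespace Realization

variable (par : Params) (R : Realization)

/-- The (labels of the) nodes that transmit in slot `k`. -/
def transmitters (k : ℕ) : Set ℕ := {i | i ∈ R.nodes ∧ R.tx k i}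

/-- The nodes that receive in slot `k`: by half-duplex, those that do not transmit. -/
def receivers (k : ℕ) : Set ℕ := {i | i ∈ R.nodes ∧ ¬ R.tx k i}

/-- Single-hop connectivity from `i` to `j` in slot `k` without the security constraint: `i`
transmits, `j` receives, they are at distance less than `eta`, and the disk of radius
`betaL * ‖x_i - x_j‖` around the receiver contains no other transmitting node. -/
def Link (k i j : ℕ) : Prop :=
  i ∈ R.transmitters k ∧ j ∈ R.receivers k ∧
    dist (R.pos i) (R.pos j) < par.eta ∧
    ∀ w ∈ R.transmitters k, w ≠ i →
      R.pos w ∉ Metric.closedBall (R.pos j) (par.betaL * dist (R.pos i) (R.pos j))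

/-- An eavesdropper at `e` decodes a message sent from `i` to `j`. -/
def HopDecodedBy (e : Plane) (i j : ℕ) : Prop :=
  e ∈ Metric.closedBall (R.pos i) (par.betaE * dist (R.pos i) (R.pos j))

/-- The edges of slot `k` of the secure connectivity graph: links whose disk of radius
`betaE * ‖x_i - x_j‖` around the transmitter contains no eavesdropper. -/
def SecureLink (k i j : ℕ) : Prop :=
  R.Link par k i j ∧ ∀ e ∈ R.eve, ¬ R.HopDecodedBy par e i j

/-- `z 0 = i, z 1, …, z N = j` together with the slots `s 0 < s 1 < … < s (N - 1)`, all of them in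
`{a, …, b}`, is a causal route for the time-varying graph with edges `E`. The route with `N = 0` is
the trivial route from a node to itself. -/
def IsCausalRoute (E : ℕ → ℕ → ℕ → Prop) (a b i j N : ℕ) (z s : ℕ → ℕ) : Prop :=
  z 0 = i ∧ z N = j ∧
    (∀ l < N, a ≤ s l ∧ s l ≤ b ∧ E (s l) (z l) (z (l + 1))) ∧
    ∀ l m, l < m → m < N → s l < s m

/-- There is a direct path from `i` to `j` in the slots `a, …, b`: a causal route each of whose
hops is secure. -/
def DirectPath (a b i j : ℕ) : Prop :=
  ∃ (N : ℕ) (z s : ℕ → ℕ), IsCausalRoute (R.SecureLink par) a b i j N z s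

/-- An eavesdropper at `e` decodes the sub-packet that travels along `z 0, …, z N`, that is, it
decodes one of its hops. -/
def RouteDecodedBy (e : Plane) (N : ℕ) (z : ℕ → ℕ) : Prop :=
  ∃ l < N, R.HopDecodedBy par e (z l) (z (l + 1))

/-- There is a split path from `i` to `j` in the slots `a, …, b`: two different causal routes from
`i` to `j`, one for each sub-packet, whose hops need not be secure, such that no eavesdropper
decodes both sub-packets. -/
def SplitPath (a b i j : ℕ) : Prop :=
  ∃ (N : ℕ) (z s : ℕ → ℕ) (N' : ℕ) (z' s' : ℕ → ℕ),
    0 < N ∧ IsCausalRoute (R.Link par) a b i j N z s ∧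
    0 < N' ∧ IsCausalRoute (R.Link par) a b i j N' z' s' ∧
    ¬ (N = N' ∧ ∀ l ≤ N, z l = z' l) ∧
    ∀ e ∈ R.eve, ¬ (R.RouteDecodedBy par e N z ∧ R.RouteDecodedBy par e N' z')

/-- There is a two-secure path from `i` to `j` in the slots `a, …, b`: a chain of nodes
`z 0 = i, …, z N = j` in which the packet is passed from `z l` to `z (l + 1)` during the slots
`s l, …, t l`, either over a secure link or over a split path, and each stage starts after the
preceding ones are complete. -/
def TwoSecurePath (a b i j : ℕ) : Prop :=
  ∃ (N : ℕ) (z s t : ℕ → ℕ), z 0 = i ∧ z N = j ∧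
    (∀ l < N, a ≤ s l ∧ t l ≤ b ∧
      ((∃ k, s l ≤ k ∧ k ≤ t l ∧ R.SecureLink par k (z l) (z (l + 1))) ∨
        R.SplitPath par (s l) (t l) (z l) (z (l + 1)))) ∧
    ∀ l m, l < m → m < N → t l < s m

end Realization

/-- The two packet forwarding schemes. -/
inductive Scheme : Type
  | direct
  | split

namespace Realization

variable (par : Params) (R : Realization)

/-- Under the given scheme a packet can be brought from `i` to `j` within the slots `a, …, b`. -/
def PathWithin : Scheme → ℕ → ℕ → ℕ → ℕ → Prop
  | Scheme.direct => R.DirectPath par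
  | Scheme.split => R.TwoSecurePath par

/-- Existence of a causal multi-hop secure path from `i` to `j` under the given scheme. -/
def Connected (σ : Scheme) (i j : ℕ) : Prop := ∃ b, R.PathWithin par σ 0 b i j

/-- `C` is an infinite set of legitimate nodes any two of which are securely connected, in both
directions. -/
def IsGiant (σ : Scheme) (C : Set ℕ) : Prop :=
  C ⊆ R.nodes ∧ C.Infinite ∧ ∀ i ∈ C, ∀ j ∈ C, R.Connected par σ i j

/-- The nodes of the giant component. -/
def giant (σ : Scheme) : Set ℕ := {i | ∃ C, R.IsGiant par σ C ∧ i ∈ C}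

/-- The minimum delay from `i` to `j`: the least `k` such that the slots `0, …, k` suffice to bring
a packet from `i` to `j` under the scheme; it is infinite if there is no such `k`. -/
def delay (σ : Scheme) (i j : ℕ) : ℝ≥0∞ :=
  ⨅ (k : ℕ) (_ : R.PathWithin par σ 0 k i j), (k : ℝ≥0∞)

/-- `i` is an element of the set `C` of nodes that is closest to the point `x`. -/
def IsNearest (C : Set ℕ) (x : Plane) (i : ℕ) : Prop :=
  i ∈ C ∧ ∀ j ∈ C, dist (R.pos i) x ≤ dist (R.pos j) x

/-- `T(0, n)`: the minimum delay, under the scheme `σ`, from the node of the set `C` that is closest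
to `(0, 0)` to the node of `C` that is closest to `(n, 0)`. For the point processes considered below
ties have probability zero; here they are resolved in favour of the smallest delay. -/
def delayTo (σ : Scheme) (C : Set ℕ) (n : ℕ) : ℝ≥0∞ :=
  ⨅ (i : ℕ) (_ : R.IsNearest C !₂[(0 : ℝ), 0] i)
    (j : ℕ) (_ : R.IsNearest C !₂[(n : ℝ), 0] j), R.delay par σ i j

end Realization

/-! ### The random network -/

/-- A point process in the plane through an enumeration of its points: the points are `pt i` for
`i < card`, where the number `card` of points may be infinite. -/
structure PointProcess (Ω : Type*) where
  card : Ω → ℕ∞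
  pt : ℕ → Ω → Plane

namespace PointProcess

variable {Ω : Type*} (Φ : PointProcess Ω)

/-- The labels of the points of the process. -/
def labels (ω : Ω) : Set ℕ := {i | (i : ℕ∞) < Φ.card ω}

/-- The number of points in the set `A`. -/
def count (A : Set Plane) (ω : Ω) : ℕ∞ := {i | i ∈ Φ.labels ω ∧ Φ.pt i ω ∈ A}.encard

/-- The process with its enumeration, as one random element. -/
def toRandom (ω : Ω) : ℕ∞ × (ℕ → Plane) := (Φ.card ω, fun i => Φ.pt i ω)

/-- `Φ` is a Poisson point process of density `lam` on the plane: the number of points in a Borel set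
of finite area is Poisson distributed with mean `lam` times the area, and the numbers of points in
disjoint Borel sets are independent. -/
structure IsPoisson [MeasurableSpace Ω] (P : Measure Ω) (lam : ℝ≥0) : Prop where
  measurable_card : Measurable Φ.card
  measurable_pt : ∀ i, Measurable (Φ.pt i)
  law_count : ∀ A : Set Plane, MeasurableSet A → volume A ≠ ∞ →
    P.map (Φ.count A) =
      (poissonMeasure (lam * (volume A).toNNReal)).map (fun m : ℕ => (m : ℕ∞))
  indep_count : ∀ (m : ℕ) (A : Fin m → Set Plane), (∀ a, MeasurableSet (A a)) →
    Pairwise (fun a b => Disjoint (A a) (A b)) → iIndepFun (fun a => Φ.count (A a)) P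

end PointProcess

/-- The random data of the network: legitimate nodes, eavesdroppers, and the ALOHA decisions
(`tx k i ω = true` if node `i` is to transmit in slot `k`). -/
structure Network (Ω : Type*) where
  legit : PointProcess Ω
  eve : PointProcess Ω
  tx : ℕ → ℕ → Ω → Bool

namespace Network

variable {Ω : Type*} (net : Network Ω)

/-- The law of the network: the legitimate nodes and the eavesdroppers are independent Poisson
point processes of densities `lamL` and `lamE`, and, independently of these, each node transmits
in each slot with probability `p`, independently over nodes and slots. -/
structure HasLaw [MeasurableSpace Ω] (P : Measure Ω) (par : Params) : Prop where
  legit_poisson : net.legit.IsPoisson P par.lamL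
  eve_poisson : net.eve.IsPoisson P par.lamE
  measurable_tx : ∀ k i, Measurable (net.tx k i)
  prob_tx : ∀ k i, P {ω | net.tx k i ω = true} = ENNReal.ofReal par.p
  indep_tx : iIndepFun (fun (q : ℕ × ℕ) => net.tx q.1 q.2) P
  indep_legit_eve : IndepFun net.legit.toRandom net.eve.toRandom P
  indep_points_tx : IndepFun (fun ω => (net.legit.toRandom ω, net.eve.toRandom ω))
    (fun ω (q : ℕ × ℕ) => net.tx q.1 q.2 ω) P

/-- The realization of the network at the outcome `ω`. -/
def realization (ω : Ω) : Realization where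
  nodes := net.legit.labels ω
  pos := fun i => net.legit.pt i ω
  eve := {e | ∃ i ∈ net.eve.labels ω, net.eve.pt i ω = e}
  tx := fun k i => net.tx k i ω = true

/-- The event that a giant component exists under the scheme `σ`. -/
def giantExists (par : Params) (σ : Scheme) : Set Ω :=
  {ω | ∃ C, (net.realization ω).IsGiant par σ C}

/-- The conditional expectation, given that a giant component of the scheme `γ` exists, of the
minimum delay under the scheme `σ` between the nodes of that giant component that are closest to
`(0, 0)` and to `(n, 0)`. -/
def condMeanDelay [MeasurableSpace Ω] (P : Measure Ω) (par : Params) (γ σ : Scheme) (n : ℕ) :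
    ℝ≥0∞ :=
  ∫⁻ ω, (net.realization ω).delayTo par σ ((net.realization ω).giant par γ) n
    ∂(P[|net.giantExists par γ])

end Network

end

end SecureNet

namespace SecureNet

namespace Realization

variable {par : Params} {R : Realization}

/-! The comparison is pathwise: in every realization the split-path scheme can imitate the
direct-path scheme in the same slots, by never splitting (`DirectPath.twoSecurePath`). Hence direct
giant components remain giant and no delay grows, outcome by outcome. Probability enters only
through monotonicity of the measure and of the integral. In the delay comparison `γ` fixes both the
component and the conditioning, so the two sides share endpoints and measure. -/

/-- A direct path is a two-secure path in which every stage is a single secure hop. -/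
theorem DirectPath.twoSecurePath {a b i j : ℕ} (h : R.DirectPath par a b i j) :
    R.TwoSecurePath par a b i j := by
  obtain ⟨N, z, s, h0, hN, hhop, hmono⟩ := h
  -- Each stage occupies the single slot `s l`, its start and its end; strict increase of the slots
  -- is then exactly the condition that stages do not overlap.
  refine ⟨N, z, s, s, h0, hN, fun l hl => ?_, hmono⟩
  obtain ⟨ha, hb, hlink⟩ := hhop l hl
  exact ⟨ha, hb, Or.inl ⟨s l, le_rfl, le_rfl, hlink⟩⟩

theorem IsGiant.split_of_direct {C : Set ℕ} (h : R.IsGiant par Scheme.direct C) :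
    R.IsGiant par Scheme.split C := by
  obtain ⟨hsub, hinf, hconn⟩ := h
  refine ⟨hsub, hinf, fun i hi j hj => ?_⟩
  obtain ⟨b, hb⟩ := hconn i hi j hj
  exact ⟨b, DirectPath.twoSecurePath hb⟩

/-- Every deadline feasible for the direct scheme is feasible for the split one, so the infimum runs
over a larger set of slots; an unreachable target has direct delay `∞`. -/
theorem delay_split_le_delay_direct (i j : ℕ) :
    R.delay par Scheme.split i j ≤ R.delay par Scheme.direct i j :=
  iInf_mono fun _ => iInf_mono' fun h => ⟨DirectPath.twoSecurePath h, le_rfl⟩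

/-- The nearest nodes depend on `C` but not on the scheme, so both infima, ties included, range over
the same pairs. -/
theorem delayTo_split_le_delayTo_direct (C : Set ℕ) (n : ℕ) :
    R.delayTo par Scheme.split C n ≤ R.delayTo par Scheme.direct C n :=
  iInf_mono fun i => iInf_mono fun _ => iInf_mono fun j => iInf_mono fun _ =>
    delay_split_le_delay_direct i j

end Realization

theorem Network.giantExists_direct_subset_split {Ω : Type*} (net : Network Ω) (par : Params) :
    net.giantExists par Scheme.direct ⊆ net.giantExists par Scheme.split :=
  fun _ ⟨C, hC⟩ => ⟨C, hC.split_of_direct⟩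

end SecureNet

theorem mainTheorem11 {Ω : Type*} [MeasurableSpace Ω] (P : MeasureTheory.Measure Ω)
    [MeasureTheory.IsProbabilityMeasure P] (par : SecureNet.Params) (net : SecureNet.Network Ω)
    (hnet : net.HasLaw P par) :
    P (net.giantExists par SecureNet.Scheme.direct) ≤
        P (net.giantExists par SecureNet.Scheme.split) ∧
      ∀ γ : SecureNet.Scheme, P (net.giantExists par γ) ≠ 0 → ∀ n : ℕ,
        net.condMeanDelay P par γ SecureNet.Scheme.split n ≤
          net.condMeanDelay P par γ SecureNet.Scheme.direct n :=
  -- Both monotonicity facts hold without measurability of the events or of the delays.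
  ⟨MeasureTheory.measure_mono (net.giantExists_direct_subset_split par), fun _ _ _ =>
    MeasureTheory.lintegral_mono fun _ =>
      SecureNet.Realization.delayTo_split_le_delayTo_direct _ _⟩
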